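/- Let $d\ge 2$. An $n$-qudit register has state space $(\mathbb C^d)^{\otimes n}$ with basis kets $|x\rangle$, $x\in\{0,\dots,d-1\}^n$. Let ${\tt INC}\,|j\rangle=|(j+1)\bmod d\rangle$. For $V\in U(d)$, a set $C$ of wires and a wire $t\notin C$, let $\wedge_C^t(V)$ be the operator that applies $V$ to wire $t$ on those basis kets in which every wire of $C$ is in state $|d-1\rangle$ and fixes all other basis kets. If $|C|=k$ this is a $k$-controlled gate $\wedge_k(V)$; on $k+1$ qudits with the last one as target it is $I_{d^{k+1}-d}\oplus V$. Put ${\tt CINC}=\wedge_1({\tt INC})$. A circuit on $n$ qudits is a finite product of gates on these $n$ qudits only (no ancillas), each gate being an arbitrary one-qudit unitary on some wire, or a ${\tt CINC}$ or ${\tt CINC}^{-1}$ on an ordered pair of distinct wires. Define the counts $$b_0=0,\quad b_1=1,\quad b_2=d^2+2d,\quad b_k=d\,(b_{\lceil (k+1)/2\rceil}+b_{\lfloor (k+1)/2\rfloor})\ (k\ge3),$$ $$\tilde b_0=0,\quad \tilde b_1=0,\quad \tilde b_2=d^2+d,\quad \tilde b_k=d\,(\tilde b_{\lceil (k+1)/2\rceil}+\tilde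 b_{\lfloor (k+1)/2\rfloor})\ (k\ge3),$$ $$c_0=\tilde c_0=0,\quad c_1=\tilde c_1=d,\quad c_k=d\,b_{k-1}+c_{k-1}+d^2,\quad \tilde c_k=d\,\tilde b_{k-1}+\tilde c_{k-1}+d^2\ (k\ge2).$$ Then the following hold. 1. Every $V\in U(d)$ has a $d$-th root $X\in U(d)$, and for every $X\in U(d)$ with $X^d=V$, every set $C$ of wires of a register and all distinct wires $a,t\notin C$, $$\wedge_{C\cup\{a\}}^{t}(V)=\wedge_{C}^{t}(X)\,\big[\wedge_{C}^{a}({\tt INC})\,\wedge_{\{a\}}^{t}(X^\dagger)\big]^{d-1}\,\wedge_{C}^{a}({\tt INC})\,\wedge_{\{a\}}^{t}(X^{d-1}).$$ 2. For all disjoint sets $A,B$ of wires of a register and all distinct wires $s,t\notin A\cup B$, $$\wedge_{A\cup B}^{t}({\tt INC})=\big[\wedge_{B\cup\{s\}}^{t}({\tt INC})\,\wedge_{A}^{s}({\tt INC})\big]^{d}.$$ 3. For every $k\ge0$, every $k$-controlled gate $\wedge_k({\tt INC})$ on a register of $k+2$ qudits is exactly the operator of a circuit on these $k+2$ qudits with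 exactly $b_k$ gates ${\tt CINC}$ and $\tilde b_k$ gates ${\tt CINC}^{-1}$. 4. For every $k\ge0$ and every $V\in U(d)$, the $k$-controlled gate $\wedge_k(V)$ on $k+1$ qudits (any one of which is the target, all others being controls) is exactly the operator of a circuit on these $k+1$ qudits with exactly $c_k$ gates ${\tt CINC}$ and $\tilde c_k$ gates ${\tt CINC}^{-1}$. 5. For $n\ge4$, $\;b_{n-2}\le (d^2+2d)(2d)\,n^{1+\log_2 d}$ and $\tilde b_{n-2}\le (d^2+d)(2d)\,n^{1+\log_2 d}$. For $n\ge3$, $$c_{n-1}\le\frac{2d^2(d^2+2d)}{2+\log_2 d}\big[(n+1)^{2+\log_2 d}-16d^2\big]+(n-2)d^2+2d,$$ $$\tilde c_{n-1}\le\frac{2d^2(d^2+d)}{2+\log_2 d}\big[(n+1)^{2+\log_2 d}-16d^2\big]+(n-2)d^2+d.$$ 6. There is a constant $K$ depending only on $d$ such that $c_k\le K\,(k+2)^{2+\log_2 d}$ and $\tilde c_k\le K\,(k+2)^{2+\log_2 d}$ for all $k\ge0$; that is, both counts are $O[(k+2)^{2+\log_2 d}]$. -/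

import Mathlib

namespace Qudit

open Matrix

/-- Operators on a register of `n` qudits of dimension `d`, written in the logical basis: the basis
kets of `H(1,d)^{⊗ n}` are the words `x : Fin n → Fin d`. -/
abbrev Op (d n : ℕ) : Type := Matrix (Fin n → Fin d) (Fin n → Fin d) ℂ

/-- The modular increment `INC |j⟩ = |(j + 1) mod d⟩`. -/
def inc (d : ℕ) : Matrix (Fin d) (Fin d) ℂ :=
  Matrix.of fun i j => if (i : ℕ) = ((j : ℕ) + 1) % d then 1 else 0

/-- The one-qudit operator `V` on wire `t`, controlled by the wires in `C` (meant for `t ∉ C`).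
It acts on every basis ket whose letters on `C` are all `d - 1` by `V` on wire `t`, and fixes every
other basis ket. With `k = #C` this is a `k`-controlled gate `∧_k(V)`; for `n = k + 1` and `t` the
last wire it is `I_{d^{k+1} - d} ⊕ V`. For `C = ∅` it is the local gate `V` on wire `t`. -/
def controlled {d n : ℕ} (C : Finset (Fin n)) (t : Fin n) (V : Matrix (Fin d) (Fin d) ℂ) :
    Op d n :=
  Matrix.of fun x y =>
    if ∀ i, i ≠ t → x i = y i then
      if ∀ c ∈ C, (y c : ℕ) + 1 = d then V (x t) (y t)
      else if x t = y t then 1 else 0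
    else 0

/-- The gate library on `n` qudits: arbitrary one-qudit unitaries on any wire, and `CINC = ∧_1(INC)`
and `CINC⁻¹` on any ordered pair (control, target) of distinct wires. -/
inductive Gate (d n : ℕ) : Type where
  | loc (t : Fin n) (U : Matrix.unitaryGroup (Fin d) ℂ) : Gate d n
  | cinc (c t : Fin n) (h : c ≠ t) : Gate d n
  | cincInv (c t : Fin n) (h : c ≠ t) : Gate d n

namespace Gate

/-- The operator performed by a gate. -/
noncomputable def op {d n : ℕ} : Gate d n → Op d n
  | loc t U => controlled ∅ t (U : Matrix (Fin d) (Fin d) ℂ)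
  | cinc c t _ => controlled {c} t (inc d)
  | cincInv c t _ => (controlled {c} t (inc d))⁻¹

def isCinc {d n : ℕ} : Gate d n → Bool
  | cinc _ _ _ => true
  | _ => false

def isCincInv {d n : ℕ} : Gate d n → Bool
  | cincInv _ _ _ => true
  | _ => false

end Gate

/-- A circuit on exactly `n` qudits (no ancillas): a list of gates in the order of the operator
product, so that the last gate of the list is applied first. -/
abbrev Circuit (d n : ℕ) : Type := List (Gate d n)

namespace Circuit

/-- The operator performed by a circuit (an exact product of the gate operators). -/
noncomputable def op {d n : ℕ} (L : Circuit d n) : Op d n := (L.map Gate.op).prod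

/-- The number of `CINC` gates. -/
def numCinc {d n : ℕ} (L : Circuit d n) : ℕ := L.countP Gate.isCinc

/-- The number of `CINC⁻¹` gates. -/
def numCincInv {d n : ℕ} (L : Circuit d n) : ℕ := L.countP Gate.isCincInv

end Circuit

/-- The halving recursion `f k = d (f ⌈(k+1)/2⌉ + f ⌊(k+1)/2⌋)` for `k ≥ 3`, with the values
`f 0 = 0`, `f 1 = f₁`, `f 2 = f₂`. -/
def halvingCount (d f₁ f₂ : ℕ) : ℕ → ℕ
  | 0 => 0
  | 1 => f₁
  | 2 => f₂
  | m + 3 => d * (halvingCount d f₁ f₂ ((m + 5) / 2) + halvingCount d f₁ f₂ ((m + 4) / 2))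
termination_by k => k
decreasing_by all_goals omega

/-- `b_k`: the number of `CINC` gates for `∧_k(INC)`. -/
def b (d : ℕ) : ℕ → ℕ := halvingCount d 1 (d ^ 2 + 2 * d)

/-- `b̃_k`: the number of `CINC⁻¹` gates for `∧_k(INC)`. -/
def bInv (d : ℕ) : ℕ → ℕ := halvingCount d 0 (d ^ 2 + d)

/-- The recursion `g k = d f (k-1) + g (k-1) + d²` for `k ≥ 2`, with `g 0 = 0` and `g 1 = d`. -/
def controlCount (d : ℕ) (f : ℕ → ℕ) : ℕ → ℕ
  | 0 => 0
  | 1 => d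
  | m + 2 => d * f (m + 1) + controlCount d f (m + 1) + d ^ 2

/-- `c_k`: the number of `CINC` gates for `∧_k(V)`. -/
def c (d : ℕ) : ℕ → ℕ := controlCount d (b d)

/-- `c̃_k`: the number of `CINC⁻¹` gates for `∧_k(V)`. -/
def cInv (d : ℕ) : ℕ → ℕ := controlCount d (bInv d)

end Qudit

open scoped Matrix

/-!
The operators in question are of two kinds: *relabellings* of the basis words (such as a controlled
`INC`, which cycles one letter of the words on which its controls are satisfied), and *multiplexed*
operators, which apply to a fixed wire `t` a matrix selected by the other letters. A controlled `V`
is multiplexed, with matrix `V ^ e x`, where `e x` is `0` or `1`. A relabelling `R` that does not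
touch `t` can be moved past a multiplexed operator `D` on `t`, which gives
`(D R)^k = D' R^k`, where the exponents of `D'` are sums of those of `D` along orbits of `R`
(`multiplexed_mul_relabel_pow`). For a controlled `INC`, `R^d = 1`, and along a full cycle the
letter `d - 1` occurs exactly once (`sum_trigger_decrement_iterate`). The root decomposition
`controlled_insert` and the halving decomposition `controlled_union_inc` then reduce to comparing
exponents.

For circuits, the base case is a singly controlled unitary. A unitary is
`W diag(exp(i θ_j)) W⁻¹`, by the spectral theorem for a Hermitian logarithm. Take out the mean
phase; what remains of `θ` sums to zero, hence is a cyclic difference, and the diagonal matrix is a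
commutator `A INC A⁻¹ INC⁻¹` with `A` diagonal. Controlling only the two increments, and turning the
controlled scalar phase into a local gate on the control wire, gives `∧_1(V)` with one `CINC` and
one `CINC⁻¹`; inserting pairs `CINC CINC⁻¹` raises both counts to exactly `d`
(`realizes_controlled_singleton`). The two decompositions now yield the circuits by induction, the
borrowed wire required by the halving being available in every recursive call
(`realizes_controlled_inc`, `realizes_controlled`).

The halving recursion is bounded on `k - 1 ≤ 2^j` by `f₂ (2d)^j` (`halvingCount_le_mul_pow`), hence
by a multiple of `n ^ (1 + log₂ d)`. The sums of these bounds are compared with an integral by means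
of Bernoulli's inequality (`rpow_le_sub_rpow_div`, `controlCount_le_rpow`).
-/

/-! ### Diagonalization and roots of unitary matrices -/

namespace Qudit

open Matrix Complex

open scoped Matrix.Norms.L2Operator in
/-- A unitary matrix has a Hermitian logarithm, namely `arg` applied to it by the continuous
functional calculus; continuity is automatic because the spectrum is finite. -/
theorem exists_exp_I_smul_hermitian {m : Type*} [Fintype m] [DecidableEq m] {V : Matrix m m ℂ}
    (hV : V ∈ unitaryGroup m ℂ) :
    ∃ H : Matrix m m ℂ, H.IsHermitian ∧ V = NormedSpace.exp (I • H) := by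
  have hn : IsStarNormal V := ⟨(mem_unitaryGroup_iff'.1 hV).trans (mem_unitaryGroup_iff.1 hV).symm⟩
  have hcont : ∀ f : ℂ → ℂ, ContinuousOn f (spectrum ℂ V) := fun f =>
    V.finite_spectrum.continuousOn f
  refine ⟨cfc (ofReal ∘ arg : ℂ → ℂ) V, IsSelfAdjoint.cfc_arg V, ?_⟩
  have h1 : I • cfc (ofReal ∘ arg : ℂ → ℂ) V = cfc (fun z : ℂ => I * (arg z : ℂ)) V :=
    (cfc_const_mul I _ V (hcont _)).symm
  rw [h1, ← CFC.exp_eq_normedSpace_exp (𝕜 := ℂ)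
    (a := cfc (fun z : ℂ => I * (arg z : ℂ)) V) (cfc_predicate _ _),
    ← cfc_comp' NormedSpace.exp (fun z : ℂ => I * (arg z : ℂ)) V
      (by rw [← Complex.exp_eq_exp_ℂ]; exact Complex.continuous_exp.continuousOn) (hcont _)]
  conv_lhs => rw [← cfc_id' ℂ V]
  refine cfc_congr fun z hz => ?_
  have hz1 : ‖z‖ = 1 := by
    simpa using spectrum.subset_circle_of_unitary hV hz
  have := norm_mul_exp_arg_mul_I z
  rw [hz1, ofReal_one, one_mul, mul_comm] at this
  simpa [← Complex.exp_eq_exp_ℂ] using this.symm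

/-- The diagonal unitary matrix with entries `exp (i θ j)`. -/
noncomputable def phaseDiag {m : Type*} [DecidableEq m] (θ : m → ℝ) : Matrix m m ℂ :=
  diagonal fun j => Complex.exp (θ j * I)

section phaseDiag
variable {m : Type*} [Fintype m] [DecidableEq m]

theorem phaseDiag_mul (θ η : m → ℝ) :
    phaseDiag θ * phaseDiag η = phaseDiag fun j => θ j + η j := by
  simp [phaseDiag, diagonal_mul_diagonal, ← Complex.exp_add, add_mul]

omit [Fintype m] in
theorem phaseDiag_conjTranspose (θ : m → ℝ) : (phaseDiag θ)ᴴ = phaseDiag fun j => -θ j := by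
  simp only [phaseDiag, diagonal_conjTranspose]
  congr 1; ext j
  simp [← Complex.exp_conj]

omit [Fintype m] in
theorem phaseDiag_zero : phaseDiag (fun _ : m => 0) = 1 := by
  simp [phaseDiag]

theorem phaseDiag_pow (θ : m → ℝ) (k : ℕ) : phaseDiag θ ^ k = phaseDiag fun j => k * θ j := by
  simp only [phaseDiag, diagonal_pow]
  congr 1; ext j
  simp [← Complex.exp_nat_mul, mul_assoc]

theorem phaseDiag_mem (θ : m → ℝ) : phaseDiag θ ∈ unitaryGroup m ℂ := by
  rw [mem_unitaryGroup_iff, star_eq_conjTranspose, phaseDiag_conjTranspose, phaseDiag_mul]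
  simp [phaseDiag_zero]

/-- Unitary diagonalization of unitary matrices, read off from that of a Hermitian logarithm. -/
theorem exists_phaseDiag_conj {V : Matrix m m ℂ} (hV : V ∈ unitaryGroup m ℂ) :
    ∃ W ∈ unitaryGroup m ℂ, ∃ θ : m → ℝ, V = W * phaseDiag θ * Wᴴ := by
  obtain ⟨H, hH, rfl⟩ := exists_exp_I_smul_hermitian hV
  refine ⟨hH.eigenvectorUnitary, hH.eigenvectorUnitary.2, hH.eigenvalues, ?_⟩
  have hW := hH.eigenvectorUnitary.2
  set W : Matrix m m ℂ := (hH.eigenvectorUnitary : Matrix m m ℂ) with hWdef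
  have hinv : W⁻¹ = Wᴴ := Matrix.inv_eq_right_inv (mem_unitaryGroup_iff.1 hW)
  have hunit : IsUnit W := IsUnit.of_mul_eq_one _ (mem_unitaryGroup_iff.1 hW)
  have h1 : H = W * diagonal (fun j => (hH.eigenvalues j : ℂ)) * Wᴴ := by
    conv_lhs => rw [hH.spectral_theorem, Unitary.conjStarAlgAut_apply]
    rfl
  have h2 : I • H = W * diagonal (fun j => (hH.eigenvalues j : ℂ) * I) * W⁻¹ := by
    have : diagonal (fun j => (hH.eigenvalues j : ℂ) * I) =
        I • diagonal (fun j => (hH.eigenvalues j : ℂ)) := by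
      rw [← diagonal_smul]; congr 1; ext j; simp [mul_comm]
    rw [this, hinv, Matrix.mul_smul, Matrix.smul_mul, ← h1]
  rw [h2, Matrix.exp_conj _ _ hunit, Matrix.exp_diagonal, hinv, phaseDiag]
  congr 3; ext j
  rw [Pi.coe_exp, ← Complex.exp_eq_exp_ℂ]

theorem exists_unitary_pow_eq {V : Matrix m m ℂ} (hV : V ∈ unitaryGroup m ℂ) {k : ℕ}
    (hk : k ≠ 0) : ∃ X ∈ unitaryGroup m ℂ, X ^ k = V := by
  obtain ⟨W, hW, θ, rfl⟩ := exists_phaseDiag_conj hV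
  have hW' : Wᴴ ∈ unitaryGroup m ℂ := Unitary.star_mem hW
  have h1 : Wᴴ * W = 1 := mem_unitaryGroup_iff'.1 hW
  refine ⟨W * phaseDiag (fun j => θ j / k) * Wᴴ,
    mul_mem (mul_mem hW (phaseDiag_mem _)) hW', ?_⟩
  have key : ∀ i, (W * phaseDiag (fun j => θ j / k) * Wᴴ) ^ i =
      W * phaseDiag (fun j => θ j / k) ^ i * Wᴴ := by
    intro i
    induction i with
    | zero => simpa [star_eq_conjTranspose] using (mem_unitaryGroup_iff.1 hW).symm
    | succ i ih =>
      rw [pow_succ, ih, pow_succ]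
      simp only [Matrix.mul_assoc]
      rw [← Matrix.mul_assoc Wᴴ W, h1, Matrix.one_mul]
  rw [key, phaseDiag_pow]
  congr 3; ext j; field_simp

end phaseDiag

/-- A real function on `ℤ/d` with mean `φ` is `φ` plus a cyclic difference: `α` collects the partial
sums of `θ - φ`, which close up around the cycle because their total is `0`. -/
theorem exists_cyclic_difference {d : ℕ} [NeZero d] (θ : Fin d → ℝ) :
    ∃ (φ : ℝ) (α : Fin d → ℝ), ∀ j, θ j = φ + (α j - α (j - 1)) := by
  obtain ⟨m, rfl⟩ : ∃ m, d = m + 1 := ⟨d - 1, (Nat.succ_pred (NeZero.ne d)).symm⟩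
  set φ : ℝ := (∑ j, θ j) / (m + 1) with hφ
  refine ⟨φ, fun j => ∑ k ∈ Finset.Iic j, (θ k - φ), fun j => ?_⟩
  refine Fin.cases ?_ (fun i => ?_) j
  -- At `0` the predecessor is the last index, where the partial sum is the total.
  · have h0 : (0 : Fin (m + 1)) - 1 = Fin.last m := by
      rw [sub_eq_iff_eq_add]; simp
    have h1 : Finset.Iic (Fin.last m) = Finset.univ := by ext; simp [Fin.le_last]
    have h2 : Finset.Iic (0 : Fin (m + 1)) = {0} := by ext; simp
    simp only [h0, h1, h2, Finset.sum_sub_distrib, Finset.card_singleton, Finset.sum_singleton,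
      Finset.sum_const, Finset.card_univ, Fintype.card_fin, nsmul_eq_mul, hφ]
    push_cast
    field_simp
    ring
  · have h0 : i.succ - 1 = i.castSucc := by
      rw [sub_eq_iff_eq_add]; exact (Fin.coeSucc_eq_succ).symm
    have h1 : Finset.Iic i.succ = insert i.succ (Finset.Iic i.castSucc) := by
      ext k
      simp only [Finset.mem_Iic, Finset.mem_insert, Fin.le_def, Fin.ext_iff, Fin.val_succ,
        Fin.val_castSucc]
      omega
    simp only [h0, h1]
    rw [Finset.sum_insert (by simp [Fin.le_def])]
    ring

/-! ### The increment matrix -/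

theorem inc_apply {d : ℕ} [NeZero d] (i j : Fin d) :
    inc d i j = if i - 1 = j then 1 else 0 := by
  have : (i : ℕ) = ((j : ℕ) + 1) % d ↔ i - 1 = j := by
    rw [sub_eq_iff_eq_add, Fin.ext_iff, Fin.val_add, Fin.val_one']
    simp
  simp only [inc, of_apply, this]

theorem inc_mul_apply {d : ℕ} [NeZero d] {m : Type*} (M : Matrix (Fin d) m ℂ) (i : Fin d) (k : m) :
    (inc d * M) i k = M (i - 1) k := by
  simp [Matrix.mul_apply, inc_apply]

theorem inc_mem {d : ℕ} [NeZero d] : inc d ∈ unitaryGroup (Fin d) ℂ := by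
  rw [mem_unitaryGroup_iff, star_eq_conjTranspose]
  ext i k
  rw [inc_mul_apply, conjTranspose_apply, inc_apply, one_apply]
  simp only [sub_left_inj, eq_comm (a := k)]
  split_ifs <;> simp

open scoped Fin.CommRing in
theorem inc_pow_apply {d : ℕ} [NeZero d] (e : ℕ) (i j : Fin d) :
    (inc d ^ e) i j = if i - (e : Fin d) = j then 1 else 0 := by
  induction e generalizing i with
  | zero => simp [one_apply]
  | succ e ih => rw [pow_succ', inc_mul_apply, ih]; simp [sub_sub, add_comm]

open scoped Fin.CommRing in
theorem inc_pow_self {d : ℕ} [NeZero d] : inc d ^ d = 1 := by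
  ext i j; rw [inc_pow_apply]; simp [one_apply]

/-- Conjugation by `INC` shifts the entries of a diagonal matrix cyclically, so a cyclic difference
of phases is a commutator with `INC`. -/
theorem phaseDiag_cyclic_difference {d : ℕ} [NeZero d] (φ : ℝ) (α : Fin d → ℝ) :
    phaseDiag (fun j => φ + (α j - α (j - 1))) =
      Complex.exp (φ * I) • (phaseDiag α * inc d * (phaseDiag α)ᴴ * (inc d)ᴴ) := by
  have h : inc d * (phaseDiag α)ᴴ = phaseDiag (fun j => -α (j - 1)) * inc d := by
    ext i k
    rw [inc_mul_apply, phaseDiag_conjTranspose]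
    simp only [phaseDiag, diagonal_mul, diagonal_apply, inc_apply]
    split_ifs <;> simp
  have hi : inc d * (inc d)ᴴ = 1 := mem_unitaryGroup_iff.1 inc_mem
  rw [Matrix.mul_assoc (phaseDiag α), h, Matrix.mul_assoc, Matrix.mul_assoc, hi, Matrix.mul_one,
    phaseDiag_mul]
  simp only [phaseDiag, ← diagonal_smul]
  congr 1; ext j
  simp only [Pi.smul_apply, smul_eq_mul, ← Complex.exp_add]
  congr 1; push_cast; ring

end Qudit

/-! ### Multiplexed operators and relabellings -/

namespace Qudit

open Matrix Function

section Multiplexed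

variable {d n : ℕ}

/-- Applies to wire `t` a one-qudit operator `g x` selected by the word `x` (meant for `g` that does
not look at the letter of `x` on wire `t`). -/
def multiplexed (t : Fin n) (g : (Fin n → Fin d) → Matrix (Fin d) (Fin d) ℂ) : Op d n :=
  Matrix.of fun x y => if ∀ i, i ≠ t → x i = y i then g x (x t) (y t) else 0

/-- `1` if every letter of `x` on `C` is `d - 1`, and `0` otherwise. -/
def trigger (C : Finset (Fin n)) (x : Fin n → Fin d) : ℕ :=
  if ∀ c ∈ C, (x c : ℕ) + 1 = d then 1 else 0

/-- The operator that composes wave functions with `σ`: its entry at `(x, y)` is `1` if `y = σ x`,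
and `0` otherwise. If `σ` is a bijection, it maps the basis ket of `σ x` to that of `x`. -/
def relabel (σ : (Fin n → Fin d) → (Fin n → Fin d)) : Op d n :=
  (1 : Op d n).submatrix σ id

theorem relabel_apply (σ : (Fin n → Fin d) → (Fin n → Fin d)) (x y : Fin n → Fin d) :
    relabel σ x y = (1 : Op d n) (σ x) y := rfl

theorem forall_ne_iff_update_eq {x y : Fin n → Fin d} {t : Fin n} :
    (∀ i, i ≠ t → x i = y i) ↔ update x t (y t) = y := by
  rw [update_eq_iff]; simp

theorem eq_iff_forall_ne_and_eq {x y : Fin n → Fin d} (t : Fin n) :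
    x = y ↔ (∀ i, i ≠ t → x i = y i) ∧ x t = y t := by
  refine ⟨by rintro rfl; simp, fun h => funext fun i => ?_⟩
  by_cases hi : i = t
  · exact hi ▸ h.2
  · exact h.1 i hi

theorem multiplexed_mul_apply (t : Fin n) (g : (Fin n → Fin d) → Matrix (Fin d) (Fin d) ℂ)
    (M : Op d n) (x y : Fin n → Fin d) :
    (multiplexed t g * M) x y = ∑ j, g x (x t) j * M (update x t j) y := by
  rw [Matrix.mul_apply]
  symm
  refine Finset.sum_of_injOn (fun j => update x t j) (fun j _ k _ h => ?_) (by simp)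
    (fun z _ hz => ?_) (fun j _ => ?_)
  · exact update_injective x t h
  · have : ¬ ∀ i, i ≠ t → x i = z i := fun h =>
      hz ⟨z t, by simp, forall_ne_iff_update_eq.1 h⟩
    simp only [multiplexed, of_apply, if_neg this, zero_mul]
  · have : ∀ i, i ≠ t → x i = update x t j i := fun i hi => by rw [update_of_ne hi]
    simp only [multiplexed, of_apply, if_pos this, update_self]

theorem relabel_mul_apply (σ : (Fin n → Fin d) → (Fin n → Fin d)) (M : Op d n)
    (x y : Fin n → Fin d) : (relabel σ * M) x y = M (σ x) y :=
  congrFun₂ (Matrix.one_mul M) (σ x) y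

theorem multiplexed_mul_multiplexed (t : Fin n) (g h : (Fin n → Fin d) → Matrix (Fin d) (Fin d) ℂ)
    (hh : ∀ x j, h (update x t j) = h x) :
    multiplexed t g * multiplexed t h = multiplexed t fun x => g x * h x := by
  ext x y
  rw [multiplexed_mul_apply]
  have : ∀ j, (∀ i, i ≠ t → update x t j i = y i) ↔ ∀ i, i ≠ t → x i = y i := fun j =>
    forall₂_congr fun i hi => by rw [update_of_ne hi]
  simp only [multiplexed, of_apply, hh, update_self, this, Matrix.mul_apply]
  split_ifs <;> simp

theorem multiplexed_one (t : Fin n) : multiplexed t (fun _ => 1) = (1 : Op d n) := by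
  ext x y
  simp only [multiplexed, of_apply, one_apply, eq_iff_forall_ne_and_eq (x := x) t, ite_and]

/-- A relabelling that does not touch the wire `t` can be moved past an operator on `t`. -/
theorem relabel_mul_multiplexed (t : Fin n) (σ : (Fin n → Fin d) → (Fin n → Fin d))
    (g : (Fin n → Fin d) → Matrix (Fin d) (Fin d) ℂ) (h₁ : ∀ x, σ x t = x t)
    (h₂ : ∀ x j, σ (update x t j) = update (σ x) t j) :
    relabel σ * multiplexed t g = multiplexed t (fun x => g (σ x)) * relabel σ := by
  ext x y
  rw [relabel_mul_apply, multiplexed_mul_apply, ← Matrix.mul_one (multiplexed t g),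
    multiplexed_mul_apply]
  refine Finset.sum_congr rfl fun j _ => ?_
  rw [h₁, relabel_apply, h₂]

theorem iterate_update_comm {σ : (Fin n → Fin d) → (Fin n → Fin d)} {t : Fin n}
    (h : ∀ x j, σ (update x t j) = update (σ x) t j) (m : ℕ) (x : Fin n → Fin d) (j : Fin d) :
    σ^[m] (update x t j) = update (σ^[m] x) t j := by
  induction m generalizing x with
  | zero => simp
  | succ m ih => rw [iterate_succ_apply, h, ih, iterate_succ_apply]

theorem relabel_pow (σ : (Fin n → Fin d) → (Fin n → Fin d)) (k : ℕ) :
    relabel σ ^ k = relabel σ^[k] := by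
  induction k with
  | zero => rfl
  | succ k ih =>
    ext x y
    rw [pow_succ', relabel_mul_apply, ih]
    rfl

theorem relabel_id : relabel id = (1 : Op d n) := by
  rfl

/-- Moving all the relabellings of `(D R)^k` to the right evaluates the exponents of `D` along the
orbit of the relabelling. -/
theorem multiplexed_mul_relabel_pow {t : Fin n} {σ : (Fin n → Fin d) → (Fin n → Fin d)}
    (Y : Matrix (Fin d) (Fin d) ℂ) {e : (Fin n → Fin d) → ℕ}
    (h₁ : ∀ x, σ x t = x t) (h₂ : ∀ x j, σ (update x t j) = update (σ x) t j)
    (he : ∀ x j, e (update x t j) = e x) (k : ℕ) :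
    ((multiplexed t fun x => Y ^ e x) * relabel σ) ^ k =
      (multiplexed t fun x => Y ^ ∑ i ∈ Finset.range k, e (σ^[i] x)) * relabel σ ^ k := by
  induction k with
  | zero => simp [multiplexed_one]
  | succ k ih =>
    have h : (fun x => Y ^ ∑ i ∈ Finset.range (k + 1), e (σ^[i] x)) =
        fun x => Y ^ e x * Y ^ ∑ i ∈ Finset.range k, e (σ^[i] (σ x)) := by
      ext1 x
      rw [← pow_add, Finset.sum_range_succ', add_comm]
      rfl
    rw [h, ← multiplexed_mul_multiplexed _ _ _ fun x j => by
        simp only [← iterate_succ_apply, iterate_update_comm h₂, he],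
      pow_succ', ih, pow_succ' (relabel σ), Matrix.mul_assoc, Matrix.mul_assoc,
      ← Matrix.mul_assoc (relabel σ), relabel_mul_multiplexed _ _ _ h₁ h₂, Matrix.mul_assoc]

theorem trigger_update {C : Finset (Fin n)} {t : Fin n} (ht : t ∉ C) (x : Fin n → Fin d)
    (j : Fin d) : trigger C (update x t j) = trigger C x := by
  have : (∀ c ∈ C, ((update x t j) c : ℕ) + 1 = d) ↔ ∀ c ∈ C, (x c : ℕ) + 1 = d :=
    forall₂_congr fun c hc => by rw [update_of_ne (ne_of_mem_of_not_mem hc ht)]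
  simp only [trigger, this]

theorem trigger_eq_zero_or_one (C : Finset (Fin n)) (x : Fin n → Fin d) :
    trigger C x = 0 ∨ trigger C x = 1 := by
  unfold trigger; split_ifs <;> simp

theorem trigger_empty (x : Fin n → Fin d) : trigger ∅ x = 1 := by simp [trigger]

theorem trigger_union (A B : Finset (Fin n)) (x : Fin n → Fin d) :
    trigger (A ∪ B) x = trigger A x * trigger B x := by
  simp only [trigger, Finset.mem_union, or_imp, forall_and, ite_and]
  split_ifs <;> rfl

theorem trigger_insert (a : Fin n) (C : Finset (Fin n)) (x : Fin n → Fin d) :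
    trigger (insert a C) x = trigger {a} x * trigger C x := by
  rw [← trigger_union, Finset.singleton_union]

theorem controlled_eq_multiplexed {C : Finset (Fin n)} {t : Fin n} (ht : t ∉ C)
    (V : Matrix (Fin d) (Fin d) ℂ) :
    controlled C t V = multiplexed t fun x => V ^ trigger C x := by
  ext x y
  simp only [controlled, multiplexed, of_apply]
  by_cases h : ∀ i, i ≠ t → x i = y i
  · have : (∀ c ∈ C, (y c : ℕ) + 1 = d) ↔ ∀ c ∈ C, (x c : ℕ) + 1 = d :=
      forall₂_congr fun c hc => by rw [h c (ne_of_mem_of_not_mem hc ht)]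
    rw [if_pos h, if_pos h]
    simp only [this, trigger]
    split_ifs with h1 <;> simp_all [one_apply]
  · rw [if_neg h, if_neg h]

theorem controlled_mul {C : Finset (Fin n)} {t : Fin n} (ht : t ∉ C)
    (V W : Matrix (Fin d) (Fin d) ℂ) :
    controlled C t V * controlled C t W = controlled C t (V * W) := by
  simp only [controlled_eq_multiplexed ht]
  rw [multiplexed_mul_multiplexed _ _ _ fun x j => by rw [trigger_update ht]]
  congr 1; ext1 x
  rcases trigger_eq_zero_or_one C x with h | h <;> simp [h]

theorem controlled_one {C : Finset (Fin n)} {t : Fin n} (ht : t ∉ C) :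
    controlled C t (1 : Matrix (Fin d) (Fin d) ℂ) = 1 := by
  simp [controlled_eq_multiplexed ht, multiplexed_one]

variable [NeZero d]

/-- Decrements the letter on wire `s` of the words whose letters on `C` are all `d - 1`. -/
def decrement (C : Finset (Fin n)) (s : Fin n) (x : Fin n → Fin d) : Fin n → Fin d :=
  if trigger C x = 1 then update x s (x s - 1) else x

/-- A relabelling sends the ket of `σ x` to that of `x`, so `INC` appears as a decrement of
words. -/
theorem controlled_inc {C : Finset (Fin n)} {s : Fin n} (hs : s ∉ C) :
    controlled C s (inc d) = relabel (decrement C s) := by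
  ext x y
  rw [controlled_eq_multiplexed hs, ← Matrix.mul_one (multiplexed _ _), multiplexed_mul_apply]
  rw [relabel_apply, decrement]
  rcases trigger_eq_zero_or_one C x with h | h
  · rw [h, if_neg zero_ne_one]
    simp [Matrix.one_apply (i := x _), -update_eq_self]
    rw [update_eq_self]
  · rw [h, if_pos rfl]
    simp [inc_apply]

theorem decrement_apply_of_ne {C : Finset (Fin n)} {s t : Fin n} (hst : s ≠ t)
    (x : Fin n → Fin d) : decrement C s x t = x t := by
  unfold decrement; split_ifs
  · rw [update_of_ne hst.symm]
  · rfl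

theorem decrement_update {C : Finset (Fin n)} {s t : Fin n} (hst : s ≠ t) (ht : t ∉ C)
    (x : Fin n → Fin d) (j : Fin d) :
    decrement C s (update x t j) = update (decrement C s x) t j := by
  simp only [decrement, trigger_update ht, update_of_ne hst]
  split_ifs
  · rw [update_comm hst.symm]
  · rfl

open scoped Fin.CommRing in
theorem decrement_iterate {C : Finset (Fin n)} {s : Fin n} (hs : s ∉ C) (x : Fin n → Fin d)
    (i : ℕ) : (decrement C s)^[i] x =
      if trigger C x = 1 then update x s (x s - (i : Fin d)) else x := by
  induction i generalizing x with
  | zero => simp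
  | succ i ih =>
    rw [iterate_succ_apply, ih]
    by_cases h : trigger C x = 1
    · simp [decrement, h, trigger_update hs, sub_sub, add_comm]
    · simp [decrement, h]

theorem relabel_decrement_pow {C : Finset (Fin n)} {s : Fin n} (hs : s ∉ C) :
    relabel (decrement C s) ^ d = (1 : Op d n) := by
  rw [relabel_pow, ← relabel_id]
  congr 1; ext1 x
  rw [decrement_iterate hs]
  simp

open scoped Fin.CommRing in
/-- Along a full cycle of decrements of wire `s`, the letter `d - 1` is met exactly once. -/
theorem sum_trigger_decrement_iterate {C : Finset (Fin n)} {s : Fin n} (hs : s ∉ C)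
    (x : Fin n → Fin d) (h : trigger C x = 1) :
    ∑ i ∈ Finset.range d, trigger {s} ((decrement C s)^[i] x) = 1 := by
  simp only [decrement_iterate hs, if_pos h]
  rw [← Fin.sum_univ_eq_sum_range fun i => trigger {s} (update x s (x s - (i : Fin d)))]
  simp only [Fin.cast_val_eq_self, ← Equiv.subLeft_apply]
  rw [Equiv.sum_comp (Equiv.subLeft (x s)) fun j => trigger {s} (update x s j)]
  have : ∀ j : Fin d, trigger {s} (update x s j) = if j = (0 : Fin d) - 1 then 1 else 0 := by
    intro j
    have hj : (j : ℕ) + 1 = d ↔ j = (0 : Fin d) - 1 := by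
      rw [eq_sub_iff_add_eq, Fin.ext_iff, Fin.val_add, Fin.val_one']
      have := j.isLt
      simp only [Nat.add_mod_mod, Fin.val_zero]
      constructor
      · intro h; rw [h, Nat.mod_self]
      · intro h
        have := Nat.le_of_dvd (Nat.succ_pos _) (Nat.dvd_of_mod_eq_zero h)
        omega
    simp only [trigger, Finset.mem_singleton, forall_eq, update_self, hj]
  simp [this]

/-- If `C` is not satisfied, `Xᴴ` is applied `d - 1` times or not at all, in step with
`X ^ (d - 1)`. If it is, the letter on `a` runs through a full cycle, and the total is
`X * X ^ (d - 1) = V` or `X * Xᴴ = 1` according to whether that letter starts as `d - 1`. -/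
theorem controlled_insert {V X : Matrix (Fin d) (Fin d) ℂ} (hX : X ∈ unitaryGroup (Fin d) ℂ)
    (hV : X ^ d = V) {C : Finset (Fin n)} {a t : Fin n} (hat : a ≠ t) (ha : a ∉ C) (ht : t ∉ C) :
    controlled (insert a C) t V =
      controlled C t X * (controlled C a (inc d) * controlled {a} t Xᴴ) ^ (d - 1) *
        controlled C a (inc d) * controlled {a} t (X ^ (d - 1)) := by
  have hta : t ∉ ({a} : Finset (Fin n)) := by simpa using hat.symm
  have hti : t ∉ insert a C := by simp [hat.symm, ht]
  have hd : d - 1 + 1 = d := Nat.succ_pred (NeZero.ne d)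
  have hXX : X * Xᴴ = 1 := mem_unitaryGroup_iff.1 hX
  have hXX' : Xᴴ * X = 1 := mem_unitaryGroup_iff'.1 hX
  have hcomm : Commute Xᴴ X := hXX'.trans hXX.symm
  rw [controlled_inc ha, controlled_eq_multiplexed hta Xᴴ, Matrix.mul_assoc (controlled C t X),
    mul_pow_mul, multiplexed_mul_relabel_pow _ (decrement_apply_of_ne hat)
      (decrement_update hat ht) (trigger_update hta), ← Matrix.mul_assoc (relabel _),
    relabel_mul_multiplexed _ _ _ (decrement_apply_of_ne hat) (decrement_update hat ht),
    Matrix.mul_assoc (multiplexed _ _), ← pow_succ', hd, relabel_decrement_pow ha, Matrix.mul_one,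
    controlled_eq_multiplexed hta, controlled_eq_multiplexed ht, controlled_eq_multiplexed hti,
    multiplexed_mul_multiplexed _ _ _ fun x j => by
      simp only [← iterate_succ_apply, iterate_update_comm (decrement_update hat ht),
        trigger_update hta],
    multiplexed_mul_multiplexed _ _ _ fun x j => by simp only [trigger_update hta]]
  simp only [← iterate_succ_apply]
  congr 1; ext1 x
  rw [trigger_insert]
  rcases trigger_eq_zero_or_one C x with h | h
  · -- The decrements do nothing, and the powers of `X` cancel.
    have : ∀ i : ℕ, (decrement C a)^[i] x = x := fun i => by
      rw [decrement_iterate ha, h]; simp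
    simp only [this, h, Finset.sum_const, Finset.card_range, smul_eq_mul, mul_zero, pow_zero,
      one_mul]
    rw [← pow_mul, ← hcomm.mul_pow, hXX', one_pow]
  · -- The letter on `a` is `d - 1` either at first or exactly once later.
    have hs := sum_trigger_decrement_iterate ha x h
    rw [show Finset.range d = Finset.range (d - 1 + 1) by rw [hd], Finset.sum_range_succ',
      iterate_zero, id_eq] at hs
    rw [h, mul_one, pow_one]
    simp only [Nat.succ_eq_add_one]
    rcases trigger_eq_zero_or_one {a} x with h' | h'
    · rw [h', add_zero] at hs
      rw [hs, h', pow_zero, pow_zero, pow_one, hXX, Matrix.mul_one]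
    · rw [h', Nat.add_eq_right] at hs
      rw [hs, h', pow_zero, pow_one, pow_one, Matrix.mul_one, ← pow_succ', hd, hV]

/-- If `A` is satisfied, the letter on `s` runs through a full cycle and is `d - 1` for
exactly one of the `d` increments of `t`; otherwise it stays constant and `t` is incremented `d` times or
never. -/
theorem controlled_union_inc {A B : Finset (Fin n)} {s t : Fin n} (hst : s ≠ t)
    (hsA : s ∉ A) (hsB : s ∉ B) (htA : t ∉ A) (htB : t ∉ B) :
    controlled (A ∪ B) t (inc d) =
      (controlled (insert s B) t (inc d) * controlled A s (inc d)) ^ d := by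
  have hti : t ∉ insert s B := by simp [hst.symm, htB]
  have htu : t ∉ A ∪ B := by simp [htA, htB]
  have hB : ∀ (i : ℕ) (x : Fin n → Fin d), trigger B ((decrement A s)^[i] x) = trigger B x := by
    intro i x
    rw [decrement_iterate hsA]
    split_ifs
    · rw [trigger_update hsB]
    · rfl
  rw [controlled_inc hsA, controlled_eq_multiplexed hti, controlled_eq_multiplexed htu,
    multiplexed_mul_relabel_pow _ (decrement_apply_of_ne hst) (decrement_update hst htA)
      (trigger_update hti), relabel_decrement_pow hsA, Matrix.mul_one]
  congr 1; ext1 x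
  simp only [trigger_insert s B, hB, ← Finset.sum_mul, trigger_union]
  rcases trigger_eq_zero_or_one A x with h | h
  · have : ∀ i : ℕ, (decrement A s)^[i] x = x := fun i => by
      rw [decrement_iterate hsA, h]; simp
    simp only [this, h, Finset.sum_const, Finset.card_range, smul_eq_mul, mul_assoc, pow_mul,
      inc_pow_self, one_pow, zero_mul, pow_zero]
  · rw [sum_trigger_decrement_iterate hsA x h, h]

end Multiplexed

end Qudit

/-! ### Circuits with prescribed gate counts -/

namespace Qudit

open Matrix Function

section Realizes

variable {d n : ℕ}

/-- `M` is the operator of a circuit with exactly `p` gates `CINC` and `q` gates `CINC⁻¹`. -/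
def Realizes (M : Op d n) (p q : ℕ) : Prop :=
  ∃ L : Circuit d n, L.op = M ∧ L.numCinc = p ∧ L.numCincInv = q

theorem Realizes.one : Realizes (1 : Op d n) 0 0 :=
  ⟨[], by simp [Circuit.op, Circuit.numCinc, Circuit.numCincInv]⟩

theorem Realizes.mul {M N : Op d n} {p q p' q' : ℕ} (hM : Realizes M p q)
    (hN : Realizes N p' q') : Realizes (M * N) (p + p') (q + q') := by
  obtain ⟨L, rfl, rfl, rfl⟩ := hM
  obtain ⟨L', rfl, rfl, rfl⟩ := hN
  exact ⟨L ++ L', by simp [Circuit.op, Circuit.numCinc, Circuit.numCincInv]⟩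

theorem Realizes.pow {M : Op d n} {p q : ℕ} (hM : Realizes M p q) (k : ℕ) :
    Realizes (M ^ k) (k * p) (k * q) := by
  induction k with
  | zero => simpa using Realizes.one
  | succ k ih => simpa only [pow_succ, Nat.succ_mul] using ih.mul hM

theorem Realizes.of_gate (g : Gate d n) :
    Realizes g.op (if g.isCinc then 1 else 0) (if g.isCincInv then 1 else 0) :=
  ⟨[g], by simp [Circuit.op, Circuit.numCinc, Circuit.numCincInv, List.countP_cons]⟩

theorem realizes_local {V : Matrix (Fin d) (Fin d) ℂ} (hV : V ∈ unitaryGroup (Fin d) ℂ)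
    (t : Fin n) : Realizes (controlled ∅ t V) 0 0 :=
  Realizes.of_gate (.loc t ⟨V, hV⟩)

theorem realizes_cinc {c t : Fin n} (h : c ≠ t) : Realizes (controlled {c} t (inc d)) 1 0 :=
  Realizes.of_gate (.cinc c t h)

variable [NeZero d]

theorem realizes_cincInv {c t : Fin n} (h : c ≠ t) :
    Realizes (controlled {c} t (inc d)ᴴ) 0 1 := by
  have htc : t ∉ ({c} : Finset (Fin n)) := by simpa using h.symm
  have : (controlled {c} t (inc d))⁻¹ = controlled {c} t (inc d)ᴴ := by
    refine Matrix.inv_eq_right_inv ?_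
    rw [controlled_mul htc, show inc d * (inc d)ᴴ = 1 from mem_unitaryGroup_iff.1 inc_mem,
      controlled_one htc]
  rw [← this]
  exact Realizes.of_gate (.cincInv c t h)

/-- Inserting cancelling pairs `CINC CINC⁻¹` raises both counts by the same amount. -/
theorem Realizes.pad {M : Op d n} {p q : ℕ} (hM : Realizes M p q) {c t : Fin n} (h : c ≠ t)
    (k : ℕ) : Realizes M (p + k) (q + k) := by
  have htc : t ∉ ({c} : Finset (Fin n)) := by simpa using h.symm
  have := hM.mul (((realizes_cinc (d := d) h).mul (realizes_cincInv h)).pow k)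
  rw [controlled_mul htc, show inc d * (inc d)ᴴ = 1 from mem_unitaryGroup_iff.1 inc_mem,
    controlled_one htc, one_pow, Matrix.mul_one] at this
  simpa using this

omit [NeZero d] in
/-- A controlled phase is a diagonal one-qudit gate on the control wire. -/
theorem controlled_singleton_smul_one (c t : Fin n) (ω : ℂ) :
    controlled {c} t (ω • (1 : Matrix (Fin d) (Fin d) ℂ)) =
      controlled ∅ c (diagonal fun j : Fin d => if (j : ℕ) + 1 = d then ω else 1) := by
  ext x y
  simp only [controlled, of_apply, Finset.mem_singleton, forall_eq, Finset.notMem_empty,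
    IsEmpty.forall_iff, implies_true, if_true, Matrix.smul_apply, smul_eq_mul, one_apply,
    diagonal_apply]
  by_cases hxy : x = y
  · subst hxy; simp
  · have hc := fun h₁ h₂ => hxy ((eq_iff_forall_ne_and_eq c).2 ⟨h₁, h₂⟩)
    have ht := fun h₁ h₂ => hxy ((eq_iff_forall_ne_and_eq t).2 ⟨h₁, h₂⟩)
    trans (0 : ℂ)
    · split_ifs with h₁ <;> simp_all
    · split_ifs with h₁ <;> simp_all

/-- Up to a phase and a change of basis, a unitary `V` is the commutator of a diagonal unitary with
`INC`, so that one `CINC` and one `CINC⁻¹` suffice for `∧_1(V)`; cancelling pairs bring both counts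
to `d`. -/
theorem realizes_controlled_singleton {V : Matrix (Fin d) (Fin d) ℂ}
    (hV : V ∈ unitaryGroup (Fin d) ℂ) {c t : Fin n} (h : c ≠ t) :
    Realizes (controlled {c} t V) d d := by
  obtain ⟨W, hW, θ, hVW⟩ := exists_phaseDiag_conj hV
  obtain ⟨φ, α, hθ⟩ := exists_cyclic_difference θ
  set ω : ℂ := Complex.exp (φ * Complex.I) with hω
  rw [funext hθ, phaseDiag_cyclic_difference, ← hω] at hVW
  have htc : t ∉ ({c} : Finset (Fin n)) := by simpa using h.symm
  have hWW : W * Wᴴ = 1 := mem_unitaryGroup_iff.1 hW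
  have hAA : phaseDiag α * (phaseDiag α)ᴴ = 1 := mem_unitaryGroup_iff.1 (phaseDiag_mem α)
  have hphase : (diagonal fun j : Fin d => if (j : ℕ) + 1 = d then ω else 1) ∈
      unitaryGroup (Fin d) ℂ := by
    have : (diagonal fun j : Fin d => if (j : ℕ) + 1 = d then ω else 1) =
        phaseDiag fun j : Fin d => if (j : ℕ) + 1 = d then φ else 0 := by
      rw [phaseDiag]
      congr 1; ext j
      split_ifs <;> simp [hω]
    rw [this]
    exact phaseDiag_mem _
  have hloc : ∀ U : Matrix (Fin d) (Fin d) ℂ, controlled ∅ t U = multiplexed t fun _ => U := by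
    intro U
    simp [controlled_eq_multiplexed (Finset.notMem_empty t), trigger_empty]
  have heq : controlled {c} t V =
      controlled ∅ t W * controlled {c} t (ω • (1 : Matrix (Fin d) (Fin d) ℂ)) *
        controlled ∅ t (phaseDiag α) * controlled {c} t (inc d) * controlled ∅ t (phaseDiag α)ᴴ *
        controlled {c} t (inc d)ᴴ * controlled ∅ t Wᴴ := by
    simp only [hloc, controlled_eq_multiplexed htc]
    rw [multiplexed_mul_multiplexed _ _ _ fun x j => by simp only [trigger_update htc],
      multiplexed_mul_multiplexed _ _ _ fun x j => rfl,
      multiplexed_mul_multiplexed _ _ _ fun x j => by simp only [trigger_update htc],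
      multiplexed_mul_multiplexed _ _ _ fun x j => rfl,
      multiplexed_mul_multiplexed _ _ _ fun x j => by simp only [trigger_update htc],
      multiplexed_mul_multiplexed _ _ _ fun x j => rfl]
    congr 1; ext1 x
    rcases trigger_eq_zero_or_one {c} x with hx | hx
    · simp [hx, Matrix.mul_assoc W, hAA, hWW]
    · simp [hx, hVW, Matrix.mul_assoc]
  have h0 := (((((realizes_local hW t).mul (realizes_local hphase c)).mul
    (realizes_local (phaseDiag_mem α) t)).mul (realizes_cinc h)).mul
    (realizes_local (Unitary.star_mem (phaseDiag_mem α)) t)).mul (realizes_cincInv h) |>.mul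
    (realizes_local (Unitary.star_mem hW) t)
  rw [← controlled_singleton_smul_one c t] at h0
  simp only [star_eq_conjTranspose] at h0
  rw [← heq] at h0
  have hd : 1 + (d - 1) = d := by have := Nat.pos_of_ne_zero (NeZero.ne d); omega
  simpa [hd] using h0.pad h (d - 1)

/-- One step of the recursion for `∧_k(V)`: remove the control `a`. -/
theorem realizes_controlled_insert {V : Matrix (Fin d) (Fin d) ℂ}
    (hV : V ∈ unitaryGroup (Fin d) ℂ) {C : Finset (Fin n)} {a t : Fin n} (hat : a ≠ t)
    (ha : a ∉ C) (ht : t ∉ C) {p q p' q' : ℕ}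
    (hC : ∀ X ∈ unitaryGroup (Fin d) ℂ, Realizes (controlled C t X) p q)
    (hinc : Realizes (controlled C a (inc d)) p' q') :
    Realizes (controlled (insert a C) t V) (d * p' + p + d ^ 2) (d * q' + q + d ^ 2) := by
  obtain ⟨X, hX, hXV⟩ := exists_unitary_pow_eq hV (NeZero.ne d)
  have hX' : Xᴴ ∈ unitaryGroup (Fin d) ℂ := Unitary.star_mem hX
  rw [controlled_insert hX hXV hat ha ht]
  have h := (((hC X hX).mul ((hinc.mul
    (realizes_controlled_singleton hX' hat)).pow (d - 1))).mul hinc).mul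
    (realizes_controlled_singleton (pow_mem hX (d - 1)) hat)
  obtain ⟨m, hm⟩ : ∃ m, d = m + 1 := ⟨d - 1, (Nat.succ_pred (NeZero.ne d)).symm⟩
  convert h using 1 <;> · simp only [hm, Nat.add_sub_cancel]; ring

/-- The wire `s` is borrowed: it is neither a control nor the target. -/
theorem realizes_controlled_inc (k : ℕ) {C : Finset (Fin n)} {s t : Fin n} (hC : C.card = k)
    (hst : s ≠ t) (hs : s ∉ C) (ht : t ∉ C) :
    Realizes (controlled C t (inc d)) (b d k) (bInv d k) := by
  induction k using Nat.strong_induction_on generalizing C s t with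
  | _ k ih =>
  match k with
  | 0 =>
    rw [Finset.card_eq_zero.1 hC]
    simpa [b, bInv, halvingCount] using realizes_local inc_mem t
  | 1 =>
    obtain ⟨c, rfl⟩ := Finset.card_eq_one.1 hC
    have hct : c ≠ t := by simpa [eq_comm] using ht
    simpa [b, bInv, halvingCount] using realizes_cinc hct
  | 2 =>
    -- Here halving does not reduce the number of controls; a `d`-th root of `INC` is used instead.
    obtain ⟨a, c, hac, rfl⟩ := Finset.card_eq_two.1 hC
    simp only [Finset.mem_insert, Finset.mem_singleton, not_or] at ht
    have h := realizes_controlled_insert (C := {c}) (inc_mem (d := d)) (Ne.symm ht.1)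
      (by simpa using hac) (by simpa using ht.2)
      (fun X hX => realizes_controlled_singleton hX (Ne.symm ht.2))
      (realizes_cinc (d := d) hac.symm)
    convert h using 1 <;> simp only [b, bInv, halvingCount] <;> ring
  | m + 3 =>
    -- Split the controls into `A` and `C \ A`. The two smaller gates leave a wire unused in turn:
    -- any wire `r` of `A` for the one with target `t`, and `t` itself for the one with target `s`.
    obtain ⟨A, hAC, hA⟩ := Finset.exists_subset_card_eq (s := C) (n := (m + 4) / 2) (by omega)
    obtain ⟨r, hr⟩ : A.Nonempty := Finset.card_pos.1 (by omega)
    have hsA : s ∉ A := fun h => hs (hAC h)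
    have htA : t ∉ A := fun h => ht (hAC h)
    have hsB : s ∉ C \ A := fun h => hs (Finset.mem_sdiff.1 h).1
    have htB : t ∉ C \ A := fun h => ht (Finset.mem_sdiff.1 h).1
    have hB : (insert s (C \ A)).card = (m + 5) / 2 := by
      rw [Finset.card_insert_of_notMem hsB, Finset.card_sdiff_of_subset hAC]
      omega
    have h := ((ih _ (by omega) hB (s := r) (t := t) (fun h => htA (h ▸ hr))
      (by simp [hr, show r ≠ s from fun h => hsA (h ▸ hr)]) (by simp [hst.symm, htB])).mul
      (ih _ (by omega) hA (s := t) (t := s) hst.symm htA hsA)).pow d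
    rw [← controlled_union_inc hst hsA hsB htA htB, Finset.union_sdiff_of_subset hAC] at h
    simpa only [b, bInv, halvingCount] using h

theorem realizes_controlled (k : ℕ) {C : Finset (Fin n)} {t : Fin n} (hC : C.card = k)
    (ht : t ∉ C) {V : Matrix (Fin d) (Fin d) ℂ} (hV : V ∈ unitaryGroup (Fin d) ℂ) :
    Realizes (controlled C t V) (c d k) (cInv d k) := by
  induction k generalizing C V with
  | zero =>
    rw [Finset.card_eq_zero.1 hC]
    simpa [c, cInv, controlCount] using realizes_local hV t
  | succ k ih =>
    obtain ⟨a, D, haD, rfl, hD⟩ := Finset.card_eq_succ.1 hC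
    simp only [Finset.mem_insert, not_or] at ht
    match k with
    | 0 =>
      rw [Finset.card_eq_zero.1 hD, insert_empty_eq]
      simpa [c, cInv, controlCount] using realizes_controlled_singleton hV (Ne.symm ht.1)
    | k + 1 =>
      -- The target wire `t` is the spare wire for the increments of `a`.
      exact realizes_controlled_insert hV (Ne.symm ht.1) haD ht.2
        (fun X hX => ih hD ht.2 hX) (realizes_controlled_inc (k + 1) hD ht.1 ht.2 haD)

end Realizes

end Qudit

/-! ### Bounds on the counts -/

namespace Qudit

/-- In terms of `F h = f (h + 1)` the recursion reads `F h = d (F ⌈h/2⌉ + F ⌊h/2⌋)`, and both halves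
of `h ≤ 2 ^ (j + 1)` are at most `2 ^ j`. -/
theorem halvingCount_le_mul_pow (d f₁ f₂ : ℕ) (hd : 1 ≤ d) (j : ℕ) :
    ∀ h, 1 ≤ h → h ≤ 2 ^ j → halvingCount d f₁ f₂ (h + 1) ≤ f₂ * (2 * d) ^ j := by
  have base : ∀ j, halvingCount d f₁ f₂ 2 ≤ f₂ * (2 * d) ^ j := fun j => by
    rw [halvingCount]
    exact Nat.le_mul_of_pos_right _ (Nat.pow_pos (by omega))
  induction j with
  | zero =>
    intro h h1 h2
    obtain rfl : h = 1 := by simpa using le_antisymm h2 h1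
    exact base 0
  | succ j ih =>
    intro h h1 h2
    match h with
    | 1 => exact base _
    | m + 2 =>
      rw [pow_succ] at h2
      have e1 := ih ((m + 3) / 2) (by omega) (by omega)
      have e2 := ih ((m + 2) / 2) (by omega) (by omega)
      rw [show (m + 3) / 2 + 1 = (m + 5) / 2 by omega] at e1
      rw [show (m + 2) / 2 + 1 = (m + 4) / 2 by omega] at e2
      rw [show m + 2 + 1 = m + 3 from rfl, halvingCount]
      calc d * (halvingCount d f₁ f₂ ((m + 5) / 2) + halvingCount d f₁ f₂ ((m + 4) / 2))
          ≤ d * (f₂ * (2 * d) ^ j + f₂ * (2 * d) ^ j) := by gcongr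
        _ = f₂ * (2 * d) ^ (j + 1) := by ring

theorem two_pow_rpow_one_add_logb {d : ℕ} (hd : 1 ≤ d) (j : ℕ) :
    ((2 : ℝ) ^ j) ^ (1 + Real.logb 2 d) = (2 * d) ^ j := by
  have hd' : (0 : ℝ) < d := by exact_mod_cast hd
  rw [← Real.rpow_natCast, ← Real.rpow_mul (by norm_num), mul_comm, Real.rpow_mul (by norm_num),
    Real.rpow_add (by norm_num), Real.rpow_one, Real.rpow_logb (by norm_num) (by norm_num) hd',
    Real.rpow_natCast]

theorem logb_two_nonneg {d : ℕ} (hd : 1 ≤ d) : 0 ≤ Real.logb 2 d :=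
  Real.logb_nonneg (by norm_num) (by exact_mod_cast hd)

theorem halvingCount_le_rpow (d f₁ f₂ : ℕ) (hd : 1 ≤ d) {n : ℕ} (hn : 4 ≤ n) :
    (halvingCount d f₁ f₂ (n - 2) : ℝ) ≤ f₂ * (2 * d) * (n : ℝ) ^ (1 + Real.logb 2 d) := by
  have hL := logb_two_nonneg hd
  -- With `2 ^ j ≤ n < 2 ^ (j + 1)`, rounding up to a power of two costs one factor `2 d`.
  set j := Nat.log 2 n with hj
  have hlt : n < 2 ^ (j + 1) := Nat.lt_pow_succ_log_self (by norm_num) n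
  have hle : 2 ^ j ≤ n := Nat.pow_log_le_self 2 (by omega)
  have h := halvingCount_le_mul_pow d f₁ f₂ hd (j + 1) (n - 3) (by omega) (by omega)
  rw [show n - 3 + 1 = n - 2 by omega] at h
  calc (halvingCount d f₁ f₂ (n - 2) : ℝ) ≤ f₂ * (2 * d) ^ (j + 1) := by exact_mod_cast h
    _ = f₂ * (2 * d) * ((2 : ℝ) ^ j) ^ (1 + Real.logb 2 d) := by
      rw [two_pow_rpow_one_add_logb hd]; ring
    _ ≤ _ := by
      gcongr
      exact_mod_cast hle

/-- The comparison of `x ^ α` with the integral of `s ^ α` over `[x, x + 1]`. -/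
theorem rpow_le_sub_rpow_div {x α : ℝ} (hx : 0 < x) (hα : 0 ≤ α) :
    x ^ α ≤ ((x + 1) ^ (α + 1) - x ^ (α + 1)) / (α + 1) := by
  have hb := one_add_mul_self_le_rpow_one_add (s := 1 / x)
    (by have := one_div_pos.2 hx; linarith) (p := α + 1) (by linarith)
  have h1 : (x + 1) ^ (α + 1) = (1 + 1 / x) ^ (α + 1) * x ^ (α + 1) := by
    rw [← Real.mul_rpow (by positivity) hx.le]
    congr 1; field_simp
  have h2 : x ^ (α + 1) = x ^ α * x := Real.rpow_add_one hx.ne' α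
  rw [le_div_iff₀ (by linarith), h1]
  have h3 := mul_le_mul_of_nonneg_right hb (Real.rpow_nonneg hx.le (α + 1))
  have h4 : (1 + (α + 1) * (1 / x)) * x ^ (α + 1) = x ^ (α + 1) + x ^ α * (α + 1) := by
    rw [h2]; field_simp
  linarith

/-- The increments of `controlCount` are summed by comparison with the integral of
`s ^ (1 + log₂ d)` from `4` to `n + 1`; the term `16 d²` is `4 ^ (2 + log₂ d)`, and for `n = 3`
equality holds. -/
theorem controlCount_le_rpow (d f₁ f₂ : ℕ) (hd : 1 ≤ d) {n : ℕ} (hn : 3 ≤ n) :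
    (controlCount d (halvingCount d f₁ f₂) (n - 1) : ℝ) ≤
      2 * (d : ℝ) ^ 2 * f₂ / (2 + Real.logb 2 d) *
          (((n : ℝ) + 1) ^ (2 + Real.logb 2 d) - 16 * (d : ℝ) ^ 2) +
        ((n : ℝ) - 2) * (d : ℝ) ^ 2 + d * (f₁ + 1) := by
  have hL := logb_two_nonneg hd
  induction n, hn using Nat.le_induction with
  | base =>
    have h4 : ((4 : ℝ)) ^ (2 + Real.logb 2 d) = 16 * (d : ℝ) ^ 2 := by
      have := two_pow_rpow_one_add_logb hd 2
      rw [show (2 : ℝ) ^ 2 = 4 by norm_num] at this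
      rw [show 2 + Real.logb 2 d = (1 + Real.logb 2 d) + 1 by ring,
        Real.rpow_add_one (by norm_num), this]
      ring
    have h3 : ((3 : ℕ) : ℝ) + 1 = 4 := by norm_num
    rw [h3, h4]
    simp only [show 3 - 1 = 0 + 2 from rfl, controlCount, zero_add,
      show halvingCount d f₁ f₂ 1 = f₁ by rw [halvingCount]]
    push_cast
    apply le_of_eq
    ring
  | succ n hn ih =>
    obtain ⟨m, rfl⟩ : ∃ m, n = m + 3 := ⟨n - 3, by omega⟩
    rw [show m + 3 + 1 - 1 = (m + 1) + 2 by omega, controlCount]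
    rw [show m + 3 - 1 = m + 1 + 1 by omega] at ih
    have hb := halvingCount_le_rpow d f₁ f₂ hd (n := m + 4) (by omega)
    rw [show m + 4 - 2 = m + 1 + 1 by omega] at hb
    have hs := rpow_le_sub_rpow_div (x := ((m + 4 : ℕ) : ℝ)) (by positivity)
      (show 0 ≤ 1 + Real.logb 2 d by linarith)
    rw [show 1 + Real.logb 2 d + 1 = 2 + Real.logb 2 d by ring] at hs
    have h1 : (d : ℝ) * (halvingCount d f₁ f₂ (m + 1 + 1) : ℝ) ≤
        2 * (d : ℝ) ^ 2 * f₂ / (2 + Real.logb 2 d) * ((((m + 4 : ℕ) : ℝ) + 1) ^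
          (2 + Real.logb 2 d) - ((m + 4 : ℕ) : ℝ) ^ (2 + Real.logb 2 d)) := by
      calc (d : ℝ) * (halvingCount d f₁ f₂ (m + 1 + 1) : ℝ)
          ≤ d * (f₂ * (2 * d) * (((((m + 4 : ℕ) : ℝ) + 1) ^ (2 + Real.logb 2 d) -
            ((m + 4 : ℕ) : ℝ) ^ (2 + Real.logb 2 d)) / (2 + Real.logb 2 d))) := by
            gcongr
            exact hb.trans (by gcongr)
        _ = _ := by ring
    have e1 : ((m + 3 : ℕ) : ℝ) + 1 = ((m + 4 : ℕ) : ℝ) := by push_cast; ring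
    have e2 : ((m + 3 + 1 : ℕ) : ℝ) = ((m + 4 : ℕ) : ℝ) := by push_cast; ring
    rw [e1] at ih
    rw [e2]
    have e3 : ((m + 4 : ℕ) : ℝ) = ((m + 3 : ℕ) : ℝ) + 1 := e1.symm
    have e4 : (((m + 4 : ℕ) : ℝ) - 2) * (d : ℝ) ^ 2 =
        (((m + 3 : ℕ) : ℝ) - 2) * (d : ℝ) ^ 2 + (d : ℝ) ^ 2 := by rw [e3]; ring
    rw [e4]
    push_cast at h1 ih ⊢
    linarith

theorem exists_controlCount_le (d f₁ f₂ : ℕ) (hd : 1 ≤ d) :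
    ∃ K : ℝ, ∀ k : ℕ, (controlCount d (halvingCount d f₁ f₂) k : ℝ) ≤
      K * ((k : ℝ) + 2) ^ (2 + Real.logb 2 d) := by
  have hL := logb_two_nonneg hd
  set β := 2 + Real.logb 2 d with hβ
  set A : ℝ := 2 * (d : ℝ) ^ 2 * f₂ / β with hA
  have hA0 : 0 ≤ A := by positivity
  have hpow : ∀ k : ℕ, (k : ℝ) + 2 ≤ ((k : ℝ) + 2) ^ β := fun k =>
    Real.self_le_rpow_of_one_le (by linarith [k.cast_nonneg (α := ℝ)]) (by linarith)
  refine ⟨A + (d : ℝ) ^ 2 + d * (f₁ + 1), fun k => ?_⟩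
  have hk : (0 : ℝ) ≤ k := k.cast_nonneg
  have hd0 : (0 : ℝ) ≤ d := d.cast_nonneg
  have hf : (0 : ℝ) ≤ f₁ := f₁.cast_nonneg
  have hsmall : (k : ℝ) * (d : ℝ) ^ 2 + d * (f₁ + 1) ≤
      ((d : ℝ) ^ 2 + d * (f₁ + 1)) * ((k : ℝ) + 2) ^ β := by
    have := mul_le_mul_of_nonneg_left (hpow k) (show 0 ≤ (d : ℝ) ^ 2 + d * (f₁ + 1) by positivity)
    nlinarith [mul_nonneg hd0 hf, mul_nonneg (mul_nonneg hd0 hf) hk, mul_nonneg hd0 hk]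
  have hAp : 0 ≤ A * ((k : ℝ) + 2) ^ β := by positivity
  match k with
  | 0 => simp only [controlCount, Nat.cast_zero]; positivity
  | 1 =>
    simp only [controlCount] at *
    nlinarith [mul_nonneg hd0 hf, mul_nonneg hk (sq_nonneg (d : ℝ))]
  | k + 2 =>
    have h := controlCount_le_rpow d f₁ f₂ hd (n := k + 3) (by omega)
    rw [show k + 3 - 1 = k + 2 by omega] at h
    have e : ((k + 3 : ℕ) : ℝ) + 1 = ((k + 2 : ℕ) : ℝ) + 2 := by push_cast; ring
    rw [e, ← hβ, ← hA] at h
    have e2 : ((k + 3 : ℕ) : ℝ) - 2 ≤ ((k + 2 : ℕ) : ℝ) := by push_cast; linarith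
    have e3 := mul_le_mul_of_nonneg_right e2 (sq_nonneg (d : ℝ))
    have e4 : 0 ≤ A * (16 * (d : ℝ) ^ 2) := by positivity
    linarith

end Qudit

theorem mainTheorem2 (d : ℕ) (hd : 2 ≤ d) :
    -- Every one-qudit unitary has a unitary `d`-th root, and each such root gives the recursion.
    (∀ V ∈ Matrix.unitaryGroup (Fin d) ℂ,
      (∃ X ∈ Matrix.unitaryGroup (Fin d) ℂ, X ^ d = V) ∧
      ∀ X ∈ Matrix.unitaryGroup (Fin d) ℂ, X ^ d = V →
        ∀ (n : ℕ) (C : Finset (Fin n)) (a t : Fin n), a ≠ t → a ∉ C → t ∉ C →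
          Qudit.controlled (insert a C) t V =
            Qudit.controlled C t X *
              (Qudit.controlled C a (Qudit.inc d) * Qudit.controlled {a} t Xᴴ) ^ (d - 1) *
              Qudit.controlled C a (Qudit.inc d) * Qudit.controlled {a} t (X ^ (d - 1))) ∧
    -- The halving decomposition of a multiply controlled increment, borrowing a wire `s`.
    (∀ (n : ℕ) (A B : Finset (Fin n)) (s t : Fin n), Disjoint A B → s ≠ t →
      s ∉ A → s ∉ B → t ∉ A → t ∉ B →
        Qudit.controlled (A ∪ B) t (Qudit.inc d) =
          (Qudit.controlled (insert s B) t (Qudit.inc d) *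
            Qudit.controlled A s (Qudit.inc d)) ^ d) ∧
    -- `∧_k(INC)` on `k + 2` qudits, with its gate counts.
    (∀ (k : ℕ) (C : Finset (Fin (k + 2))) (t : Fin (k + 2)), C.card = k → t ∉ C →
      ∃ L : Qudit.Circuit d (k + 2), L.op = Qudit.controlled C t (Qudit.inc d) ∧
        L.numCinc = Qudit.b d k ∧ L.numCincInv = Qudit.bInv d k) ∧
    -- `∧_k(V)` on `k + 1` qudits (all wires other than `t` are controls), with its gate counts.
    (∀ (k : ℕ) (t : Fin (k + 1)), ∀ V ∈ Matrix.unitaryGroup (Fin d) ℂ,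
      ∃ L : Qudit.Circuit d (k + 1), L.op = Qudit.controlled {t}ᶜ t V ∧
        L.numCinc = Qudit.c d k ∧ L.numCincInv = Qudit.cInv d k) ∧
    -- Explicit bounds on the counts.
    (∀ n : ℕ, 4 ≤ n →
      (Qudit.b d (n - 2) : ℝ) ≤
        ((d : ℝ) ^ 2 + 2 * d) * (2 * d) * (n : ℝ) ^ (1 + Real.logb 2 d) ∧
      (Qudit.bInv d (n - 2) : ℝ) ≤
        ((d : ℝ) ^ 2 + d) * (2 * d) * (n : ℝ) ^ (1 + Real.logb 2 d)) ∧
    (∀ n : ℕ, 3 ≤ n →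
      (Qudit.c d (n - 1) : ℝ) ≤
        2 * (d : ℝ) ^ 2 * ((d : ℝ) ^ 2 + 2 * d) / (2 + Real.logb 2 d) *
            (((n : ℝ) + 1) ^ (2 + Real.logb 2 d) - 16 * (d : ℝ) ^ 2) +
          ((n : ℝ) - 2) * (d : ℝ) ^ 2 + 2 * d ∧
      (Qudit.cInv d (n - 1) : ℝ) ≤
        2 * (d : ℝ) ^ 2 * ((d : ℝ) ^ 2 + d) / (2 + Real.logb 2 d) *
            (((n : ℝ) + 1) ^ (2 + Real.logb 2 d) - 16 * (d : ℝ) ^ 2) +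
          ((n : ℝ) - 2) * (d : ℝ) ^ 2 + d) ∧
    -- The asymptotic bounds, with a constant that depends on `d` only.
    (∃ K : ℝ, ∀ k : ℕ,
      (Qudit.c d k : ℝ) ≤ K * ((k : ℝ) + 2) ^ (2 + Real.logb 2 d) ∧
      (Qudit.cInv d k : ℝ) ≤ K * ((k : ℝ) + 2) ^ (2 + Real.logb 2 d)) := by
  have hd1 : 1 ≤ d := by omega
  have : NeZero d := ⟨by omega⟩
  refine ⟨fun V hV => ⟨Qudit.exists_unitary_pow_eq hV (by omega), fun X hX hXV n C a t =>
      Qudit.controlled_insert hX hXV⟩,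
    fun n A B s t _ => Qudit.controlled_union_inc, fun k C t hC ht => ?_,
    fun k t V hV => Qudit.realizes_controlled k (by simp [Finset.card_compl]) (by simp) hV,
    fun n hn => ⟨?_, ?_⟩, fun n hn => ⟨?_, ?_⟩, ?_⟩
  · obtain ⟨s, hs⟩ : ∃ s, s ∉ insert t C := by
      by_contra! h
      have := Finset.card_le_card (fun x _ => h x : Finset.univ ⊆ insert t C)
      rw [Finset.card_insert_of_notMem ht, hC, Finset.card_univ, Fintype.card_fin] at this
      omega
    rw [Finset.mem_insert, not_or] at hs
    exact Qudit.realizes_controlled_inc k hC hs.1 hs.2 ht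
  · have h := Qudit.halvingCount_le_rpow d 1 (d ^ 2 + 2 * d) hd1 hn
    push_cast at h
    exact h
  · have h := Qudit.halvingCount_le_rpow d 0 (d ^ 2 + d) hd1 hn
    push_cast at h
    exact h
  · have h := Qudit.controlCount_le_rpow d 1 (d ^ 2 + 2 * d) hd1 hn
    push_cast at h
    exact h.trans_eq (by ring)
  · have h := Qudit.controlCount_le_rpow d 0 (d ^ 2 + d) hd1 hn
    push_cast at h
    exact h.trans_eq (by ring)
  · obtain ⟨K, hK⟩ := Qudit.exists_controlCount_le d 1 (d ^ 2 + 2 * d) hd1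
    obtain ⟨K', hK'⟩ := Qudit.exists_controlCount_le d 0 (d ^ 2 + d) hd1
    refine ⟨max K K', fun k => ⟨(hK k).trans ?_, (hK' k).trans ?_⟩⟩
    · gcongr
      exact le_max_left _ _
    · gcongr
      exact le_max_right _ _
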